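/- Let $A$ be a ring with identity. Let $\mathrm{mod}\text{-}A$ be the category of finitely presented right $A$-modules, and let $\mathrm{mod}\text{-}(\mathrm{mod}\text{-}A)$ be the category of finitely presented functors $F:\mathrm{mod}\text{-}A\to\mathrm{Ab}$, that is, those for which there is a sequence of natural transformations $\mathrm{Hom}_A(Y,-)\to\mathrm{Hom}_A(X,-)\to F\to 0$ with $X,Y\in\mathrm{mod}\text{-}A$ that is exact at every object of $\mathrm{mod}\text{-}A$. Let $\mathbb{A}$ be the category with objects $A^n$ ($n\ge 0$) and $\mathrm{Hom}(A^n,A^m)=\mathrm{Mat}_{m\times n}(A)$, matrices acting from the left on column vectors. Let $\mathrm{III}(\mathbb{A})$ be Adelman's category: its objects are chains $X_1\xrightarrow{f_1}X_2\xrightarrow{f_2}X_3$ in $\mathbb{A}$ (with no condition on $f_2f_1$), and its morphisms are the commutative diagrams $(\alpha_1,\alpha_2,\alpha_3)$ from $(f_1,f_2)$ to $(g_1,g_2)$ modulo the null-homotopic ones, i.e. those with $\alpha_2=g_1s+tf_2$ for some $s:X_2\to Y_1$, $t:X_3\to Y_2$. Then there are mutually inverse additive equivalences $$\mathfrak{k}:\big(\mathrm{mod}\text{-}(\mathrm{mod}\text{-}A)\big)^{op}\to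 \mathrm{III}(\mathbb{A}),\qquad \mathfrak{k}^{-1}:\mathrm{III}(\mathbb{A})\to\big(\mathrm{mod}\text{-}(\mathrm{mod}\text{-}A)\big)^{op},$$ which are canonical in the sense that they commute, up to natural isomorphism, with the canonical functors from $A$ (as a category with a single object) given by $A\mapsto\mathrm{Hom}_A(A,-)$ and $A\mapsto(0\to A\to 0)$, such that the following hold. (1) Let $\mathrm{Hom}_A(Y,-)\xrightarrow{\mathrm{Hom}(f,-)}\mathrm{Hom}_A(X,-)\to F\to 0$ be a projective presentation of $F$, where $f:X\to Y$ is a morphism in $\mathrm{mod}\text{-}A$, and let $A^m\xrightarrow{a}A^n\xrightarrow{p}X\to 0$ and $A^k\xrightarrow{d}A^l\xrightarrow{q}Y\to 0$ be free presentations with matrices $b:A^m\to A^k$ and $c:A^n\to A^l$ such that $ca=db$ and $fp=qc$. Then $$\mathfrak{k}(F)\cong\Big(A^m\oplus A^k\xrightarrow{\begin{bmatrix}a&0\\ b&-1\end{bmatrix}}A^n\oplus A^k\xrightarrow{\begin{bmatrix}c&-d\end{bmatrix}}A^l\Big).$$ Every $F$ has such a projective presentation, and every $f$ has such a pair of free presentations.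 (2) Let $A^m\xrightarrow{u}A^n\xrightarrow{v}A^r$ be a chain, let $A^m\xrightarrow{u}A^n\xrightarrow{p}X\to 0$ and $A^m\xrightarrow{vu}A^r\xrightarrow{q}Y\to 0$ be exact with $X,Y\in\mathrm{mod}\text{-}A$, and let $f:X\to Y$ satisfy $fp=qv$. Then $F=\mathfrak{k}^{-1}(u,v)$ admits a projective presentation $\mathrm{Hom}_A(Y,-)\xrightarrow{\mathrm{Hom}(f,-)}\mathrm{Hom}_A(X,-)\to F\to 0$. Such $X$, $Y$ and $f$ exist for every chain. -/

import Mathlib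

open CategoryTheory Opposite

universe u v

noncomputable section

/-! ### Three-term chains and Adelman's category -/

/-- A three-term chain `X₁ ⟶ X₂ ⟶ X₃` (the composite need not vanish). -/
structure Chain3 (C : Type u) [Category.{v} C] where
  X₁ : C
  X₂ : C
  X₃ : C
  f₁ : X₁ ⟶ X₂
  f₂ : X₂ ⟶ X₃

namespace Chain3

variable {C : Type u} [Category.{v} C]

/-- A morphism of chains: a commutative diagram with the two chains as rows. -/
@[ext]
structure Hom (X Y : Chain3 C) where
  α₁ : X.X₁ ⟶ Y.X₁
  α₂ : X.X₂ ⟶ Y.X₂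
  α₃ : X.X₃ ⟶ Y.X₃
  comm₁ : X.f₁ ≫ α₂ = α₁ ≫ Y.f₁
  comm₂ : X.f₂ ≫ α₃ = α₂ ≫ Y.f₂

instance : Category (Chain3 C) where
  Hom X Y := Hom X Y
  id X := ⟨𝟙 _, 𝟙 _, 𝟙 _, by simp, by simp⟩
  comp φ ψ := ⟨φ.α₁ ≫ ψ.α₁, φ.α₂ ≫ ψ.α₂, φ.α₃ ≫ ψ.α₃,
    by rw [← Category.assoc, φ.comm₁, Category.assoc, ψ.comm₁, Category.assoc],
    by rw [← Category.assoc, φ.comm₂, Category.assoc, ψ.comm₂, Category.assoc]⟩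
  id_comp φ := Hom.ext (Category.id_comp _) (Category.id_comp _) (Category.id_comp _)
  comp_id φ := Hom.ext (Category.comp_id _) (Category.comp_id _) (Category.comp_id _)
  assoc _ _ _ := Hom.ext (Category.assoc _ _ _) (Category.assoc _ _ _) (Category.assoc _ _ _)

@[ext]
lemma hom_ext {X Y : Chain3 C} {φ ψ : X ⟶ Y} (h₁ : φ.α₁ = ψ.α₁) (h₂ : φ.α₂ = ψ.α₂)
    (h₃ : φ.α₃ = ψ.α₃) : φ = ψ := Hom.ext h₁ h₂ h₃

@[simp] lemma id_α₁ (X : Chain3 C) : Hom.α₁ (𝟙 X) = 𝟙 X.X₁ := rfl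
@[simp] lemma id_α₂ (X : Chain3 C) : Hom.α₂ (𝟙 X) = 𝟙 X.X₂ := rfl
@[simp] lemma id_α₃ (X : Chain3 C) : Hom.α₃ (𝟙 X) = 𝟙 X.X₃ := rfl

section

variable {X Y Z : Chain3 C} (φ : X ⟶ Y) (ψ : Y ⟶ Z)

@[simp] lemma comp_α₁ : Hom.α₁ (φ ≫ ψ) = φ.α₁ ≫ ψ.α₁ := rfl
@[simp] lemma comp_α₂ : Hom.α₂ (φ ≫ ψ) = φ.α₂ ≫ ψ.α₂ := rfl
@[simp] lemma comp_α₃ : Hom.α₃ (φ ≫ ψ) = φ.α₃ ≫ ψ.α₃ := rfl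

end

variable [Preadditive C]

section

variable {X Y : Chain3 C}

instance : Zero (X ⟶ Y) := ⟨⟨0, 0, 0, by simp, by simp⟩⟩
instance : Add (X ⟶ Y) := ⟨fun φ ψ => ⟨φ.α₁ + ψ.α₁, φ.α₂ + ψ.α₂, φ.α₃ + ψ.α₃,
  by simp [φ.comm₁, ψ.comm₁], by simp [φ.comm₂, ψ.comm₂]⟩⟩
instance : Neg (X ⟶ Y) := ⟨fun φ => ⟨-φ.α₁, -φ.α₂, -φ.α₃, by simp [φ.comm₁], by simp [φ.comm₂]⟩⟩

@[simp] lemma zero_α₁ : Hom.α₁ (0 : X ⟶ Y) = 0 := rfl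
@[simp] lemma zero_α₂ : Hom.α₂ (0 : X ⟶ Y) = 0 := rfl
@[simp] lemma zero_α₃ : Hom.α₃ (0 : X ⟶ Y) = 0 := rfl
@[simp] lemma add_α₁ (φ ψ : X ⟶ Y) : Hom.α₁ (φ + ψ) = φ.α₁ + ψ.α₁ := rfl
@[simp] lemma add_α₂ (φ ψ : X ⟶ Y) : Hom.α₂ (φ + ψ) = φ.α₂ + ψ.α₂ := rfl
@[simp] lemma add_α₃ (φ ψ : X ⟶ Y) : Hom.α₃ (φ + ψ) = φ.α₃ + ψ.α₃ := rfl
@[simp] lemma neg_α₁ (φ : X ⟶ Y) : Hom.α₁ (-φ) = -φ.α₁ := rfl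
@[simp] lemma neg_α₂ (φ : X ⟶ Y) : Hom.α₂ (-φ) = -φ.α₂ := rfl
@[simp] lemma neg_α₃ (φ : X ⟶ Y) : Hom.α₃ (-φ) = -φ.α₃ := rfl

instance : AddCommGroup (X ⟶ Y) where
  add_assoc _ _ _ := hom_ext (add_assoc _ _ _) (add_assoc _ _ _) (add_assoc _ _ _)
  zero_add _ := hom_ext (zero_add _) (zero_add _) (zero_add _)
  add_zero _ := hom_ext (add_zero _) (add_zero _) (add_zero _)
  add_comm _ _ := hom_ext (add_comm _ _) (add_comm _ _) (add_comm _ _)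
  neg_add_cancel _ := hom_ext (neg_add_cancel _) (neg_add_cancel _) (neg_add_cancel _)
  nsmul := nsmulRec
  zsmul := zsmulRec

end

/-- Morphisms of chains are added componentwise. -/
instance : Preadditive (Chain3 C) where
  add_comp _ _ _ _ _ _ := by ext <;> simp
  comp_add _ _ _ _ _ _ := by ext <;> simp

/-- `(α₁, α₂, α₃)` is null-homotopic if `α₂ = g₁ s + t f₂` for some `s : X₂ ⟶ Y₁` and
`t : X₃ ⟶ Y₂`. -/
def NullHomotopic {X Y : Chain3 C} (φ : X ⟶ Y) : Prop :=
  ∃ (s : X.X₂ ⟶ Y.X₁) (t : X.X₃ ⟶ Y.X₂), φ.α₂ = s ≫ Y.f₁ + X.f₂ ≫ t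

variable (C) in
/-- Two morphisms of chains are homotopic if their difference is null-homotopic. -/
def homotopic : HomRel (Chain3 C) := fun _ _ φ ψ => NullHomotopic (φ - ψ)

lemma homotopic_iff {X Y : Chain3 C} (φ ψ : X ⟶ Y) : homotopic C φ ψ ↔
    ∃ (s : X.X₂ ⟶ Y.X₁) (t : X.X₃ ⟶ Y.X₂), φ.α₂ = s ≫ Y.f₁ + X.f₂ ≫ t + ψ.α₂ := by
  simp only [homotopic, NullHomotopic, sub_eq_add_neg, add_α₂, neg_α₂]
  simp only [← sub_eq_add_neg, sub_eq_iff_eq_add]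

instance : Congruence (homotopic C) where
  equivalence :=
    { refl := fun φ => (homotopic_iff _ _).2 ⟨0, 0, by simp⟩
      symm := fun {φ ψ} h => by
        obtain ⟨s, t, h⟩ := (homotopic_iff _ _).1 h
        exact (homotopic_iff _ _).2 ⟨-s, -t, by rw [h]; simp; abel⟩
      trans := fun {φ ψ χ} h h' => by
        obtain ⟨s, t, h⟩ := (homotopic_iff _ _).1 h
        obtain ⟨s', t', h'⟩ := (homotopic_iff _ _).1 h'
        exact (homotopic_iff _ _).2 ⟨s + s', t + t', by rw [h, h']; simp; abel⟩ }
  comp_left {X Y Z} φ {ψ ψ'} h := by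
    obtain ⟨s, t, h⟩ := (homotopic_iff _ _).1 h
    refine (homotopic_iff _ _).2 ⟨φ.α₂ ≫ s, φ.α₃ ≫ t, ?_⟩
    simp only [comp_α₂, h, Preadditive.comp_add, Category.assoc]
    rw [← Category.assoc X.f₂, φ.comm₂, Category.assoc]
  comp_right {X Y Z} {φ φ'} ψ h := by
    obtain ⟨s, t, h⟩ := (homotopic_iff _ _).1 h
    refine (homotopic_iff _ _).2 ⟨s ≫ ψ.α₁, t ≫ ψ.α₂, ?_⟩
    simp only [comp_α₂, h, Preadditive.add_comp, Category.assoc]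
    rw [ψ.comm₁]

lemma homotopic_add ⦃X Y : Chain3 C⦄ (φ₁ φ₂ ψ₁ ψ₂ : X ⟶ Y) (h : homotopic C φ₁ φ₂)
    (h' : homotopic C ψ₁ ψ₂) : homotopic C (φ₁ + ψ₁) (φ₂ + ψ₂) := by
  obtain ⟨s, t, h⟩ := (homotopic_iff _ _).1 h
  obtain ⟨s', t', h'⟩ := (homotopic_iff _ _).1 h'
  exact (homotopic_iff _ _).2 ⟨s + s', t + t', by simp [h, h']; abel⟩

end Chain3

/-- Adelman's category over `C`: three-term chains over `C`, with morphisms of chains modulo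
null-homotopic ones. -/
abbrev Adelman (C : Type u) [Category.{v} C] [Preadditive C] := Quotient (Chain3.homotopic C)

instance (C : Type u) [Category.{v} C] [Preadditive C] : Preadditive (Adelman C) :=
  Quotient.preadditive _ Chain3.homotopic_add

section Ring

variable (A : Type u) [Ring A]

/-! ### The category of matrices -/

/-- The additive category with objects `A^n`, `n = 0, 1, 2, …`; a morphism `A^n ⟶ A^m` is an
`m × n` matrix, acting from the left on column vectors. -/
structure MatObj (A : Type u) where
  n : ℕ

instance : Category (MatObj A) where
  Hom X Y := Matrix (Fin Y.n) (Fin X.n) A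
  id _ := 1
  comp U V := V * U
  id_comp U := Matrix.mul_one U
  comp_id U := Matrix.one_mul U
  assoc U V W := (Matrix.mul_assoc W V U).symm

instance : Preadditive (MatObj A) where
  homGroup X Y := inferInstanceAs (AddCommGroup (Matrix (Fin Y.n) (Fin X.n) A))
  add_comp _ _ _ U U' V := Matrix.mul_add V U U'
  comp_add _ _ _ U V V' := Matrix.add_mul V V' U

variable {A} in
/-- The chain `A^m ⟶ A^n ⟶ A^p` given by matrices `u` and `v`, as an object of Adelman's
category. -/
def matChain {m n p : ℕ} (u : Matrix (Fin n) (Fin m) A) (v : Matrix (Fin p) (Fin n) A) :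
    Adelman (MatObj A) where
  as := { X₁ := ⟨m⟩, X₂ := ⟨n⟩, X₃ := ⟨p⟩, f₁ := u, f₂ := v }

/-- The functor `A^n ↦ (0 ⟶ A^n ⟶ 0)` to chains; the object `0` is `A^0`. -/
def MatObj.toChain : MatObj A ⥤ Chain3 (MatObj A) where
  obj X := { X₁ := ⟨0⟩, X₂ := X, X₃ := ⟨0⟩, f₁ := 0, f₂ := 0 }
  map U := ⟨0, U, 0, by simp, by simp⟩
  map_id _ := Chain3.hom_ext (Matrix.ext fun i _ => i.elim0) rfl (Matrix.ext fun i _ => i.elim0)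
  map_comp _ _ :=
    Chain3.hom_ext (Matrix.ext fun i _ => i.elim0) rfl (Matrix.ext fun i _ => i.elim0)

/-- The functor `A^n ↦ (0 ⟶ A^n ⟶ 0)` to Adelman's category. -/
def MatObj.toAdelman : MatObj A ⥤ Adelman (MatObj A) :=
  MatObj.toChain A ⋙ Quotient.functor _

/-! ### Finitely presented right modules -/

/-- Finitely presented right `A`-modules, i.e. finitely presented modules over `Aᵐᵒᵖ`. -/
def isFPModule : ObjectProperty (ModuleCat.{u} Aᵐᵒᵖ) := fun M => Module.FinitePresentation Aᵐᵒᵖ M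

/-- The category `mod-A` of finitely presented right `A`-modules. -/
abbrev FPMod := (isFPModule A).FullSubcategory

variable {A} in
/-- Left multiplication of column vectors by a matrix, as a map of right modules. -/
def matLin {m n : ℕ} (U : Matrix (Fin n) (Fin m) A) : (Fin m → A) →ₗ[Aᵐᵒᵖ] (Fin n → A) where
  toFun x := U.mulVec x
  map_add' x y := Matrix.mulVec_add U x y
  map_smul' r x := Matrix.mulVec_smul U r x

instance finitePresentation_free (n : ℕ) : Module.FinitePresentation Aᵐᵒᵖ (Fin n → A) :=
  haveI : Module.FinitePresentation Aᵐᵒᵖ A :=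
    Module.FinitePresentation.of_equiv (M := Aᵐᵒᵖ)
      { toFun := MulOpposite.unop
        invFun := MulOpposite.op
        map_add' := fun _ _ => rfl
        map_smul' := fun _ _ => rfl
        left_inv := fun _ => rfl
        right_inv := fun _ => rfl }
  inferInstance

/-- The functor from the matrix category to `mod-A`, sending the object `n` to the module of
column vectors `A^n`. -/
def MatObj.toMod : MatObj A ⥤ FPMod A where
  obj X := ⟨ModuleCat.of Aᵐᵒᵖ (Fin X.n → A), finitePresentation_free A X.n⟩
  map U := ObjectProperty.homMk (ModuleCat.ofHom (matLin U))
  map_id X := by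
    ext : 2
    exact LinearMap.ext fun x => Matrix.one_mulVec x
  map_comp U V := by
    ext : 2
    exact LinearMap.ext fun x => (Matrix.mulVec_mulVec x V U).symm

instance : (MatObj.toMod A).Faithful where
  map_injective {X Y U V} h := by
    refine Matrix.mulVec_injective ?_
    funext x
    exact congrArg (fun g => g.hom.hom x) h

instance : (MatObj.toMod A).Full where
  map_surjective {X Y} g := by
    let g' : (Fin X.n → A) →ₗ[Aᵐᵒᵖ] (Fin Y.n → A) := g.hom.hom
    refine ⟨Matrix.of fun i j => g' (Pi.single j 1) i, ?_⟩
    ext : 2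
    refine LinearMap.pi_ext (f := matLin (Matrix.of fun i j => g' (Pi.single j 1) i)) (g := g')
      fun j x => ?_
    have h : (Pi.single j x : Fin X.n → A) = MulOpposite.op x • Pi.single j (1 : A) := by
      rw [← Pi.single_smul]
      simp
    rw [h, map_smul, map_smul]
    congr 1
    ext i
    simp [matLin]

/-! ### Finitely presented functors -/

variable {A}

/-- `G ⟶ H ⟶ F ⟶ 0` is exact when evaluated at any finitely presented module. -/
def RightExact {G H F : FPMod A ⥤ AddCommGrpCat.{u}} (φ : G ⟶ H) (π : H ⟶ F) : Prop :=
  ∀ M : FPMod A, Function.Exact (φ.app M) (π.app M) ∧ Function.Surjective (π.app M)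

/-- The representable functor `Hom(X, -)` on `mod-A`. -/
abbrev homFrom (X : FPMod A) : FPMod A ⥤ AddCommGrpCat.{u} := preadditiveCoyoneda.obj (op X)

/-- The natural transformation `Hom(f, -) : Hom(Y, -) ⟶ Hom(X, -)`. -/
abbrev homFromMap {X Y : FPMod A} (f : X ⟶ Y) : homFrom Y ⟶ homFrom X :=
  preadditiveCoyoneda.map f.op

variable (A) in
/-- A functor `F` on `mod-A` is finitely presented if there is an exact sequence
`Hom(Y, -) ⟶ Hom(X, -) ⟶ F ⟶ 0` with `X`, `Y` in `mod-A`. -/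
def isFPFunctor : ObjectProperty (FPMod A ⥤ AddCommGrpCat.{u}) := fun F =>
  ∃ (X Y : FPMod A) (φ : homFrom Y ⟶ homFrom X) (π : homFrom X ⟶ F), RightExact φ π

variable (A) in
/-- The category `mod-(mod-A)` of finitely presented functors from `mod-A` to abelian groups. -/
abbrev FPFun := (isFPFunctor A).FullSubcategory

lemma isFPFunctor_homFrom (X : FPMod A) : isFPFunctor A (homFrom X) :=
  ⟨X, X, 0, 𝟙 _, fun _ => ⟨fun y => ⟨fun h => ⟨0, h.symm⟩, by rintro ⟨_, rfl⟩; rfl⟩,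
    fun y => ⟨y, rfl⟩⟩⟩

variable (A) in
/-- The functor `X ↦ Hom(X, -)` from `mod-A` to the opposite of `mod-(mod-A)`. -/
def FPMod.toFPFun : FPMod A ⥤ (FPFun A)ᵒᵖ where
  obj X := op ⟨homFrom X, isFPFunctor_homFrom X⟩
  map f := (ObjectProperty.homMk (homFromMap f)).op
  map_id X := by
    apply Quiver.Hom.unop_inj
    ext : 1
    exact preadditiveCoyoneda.map_id (op X)
  map_comp f g := by
    apply Quiver.Hom.unop_inj
    ext : 1
    exact preadditiveCoyoneda.map_comp g.op f.op

/-- A projective presentation `Hom(Y, -) ⟶ Hom(X, -) ⟶ F ⟶ 0` whose first map is `Hom(f, -)`. -/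
structure ProjPresentation {X Y : FPMod A} (f : X ⟶ Y) (F : FPFun A) where
  π : homFrom X ⟶ F.obj
  exact : RightExact (homFromMap f) π

/-- A commutative diagram with exact rows
```
A^m --a--> A^n --p--> X --> 0
 |b         |c        |f
A^k --d--> A^l --q--> Y --> 0
```
-/
structure FreeDiagram {m n k l : ℕ} (a : Matrix (Fin n) (Fin m) A) (b : Matrix (Fin k) (Fin m) A)
    (c : Matrix (Fin l) (Fin n) A) (d : Matrix (Fin l) (Fin k) A) {X Y : FPMod A} (f : X ⟶ Y) where
  p : (MatObj.toMod A).obj ⟨n⟩ ⟶ X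
  q : (MatObj.toMod A).obj ⟨l⟩ ⟶ Y
  exact_p : Function.Exact (matLin a) p.hom.hom
  surjective_p : Function.Surjective p.hom.hom
  exact_q : Function.Exact (matLin d) q.hom.hom
  surjective_q : Function.Surjective q.hom.hom
  comm_left : c * a = d * b
  comm_right : p ≫ f = (MatObj.toMod A).map c ≫ q

/-- The chain `A^m ⊕ A^k ⟶ A^n ⊕ A^k ⟶ A^l` with maps `[[a, 0], [b, -1]]` and `[c, -d]`. -/
def blockChain {m n k l : ℕ} (a : Matrix (Fin n) (Fin m) A) (b : Matrix (Fin k) (Fin m) A)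
    (c : Matrix (Fin l) (Fin n) A) (d : Matrix (Fin l) (Fin k) A) : Adelman (MatObj A) :=
  matChain
    ((Matrix.fromBlocks a 0 b (-1 : Matrix (Fin k) (Fin k) A)).reindex finSumFinEquiv finSumFinEquiv)
    ((Matrix.fromCols c (-d)).reindex (Equiv.refl (Fin l)) finSumFinEquiv)

/-! ### The embeddings of the ring -/

variable (A)

/-- The embedding of `A`, as a category with one object, into the matrix category. -/
def ringToMat : SingleObj A ⥤ MatObj A where
  obj _ := ⟨1⟩
  map r := (Matrix.of fun _ _ => r : Matrix (Fin 1) (Fin 1) A)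
  map_id _ := Matrix.ext fun i j => by
    rw [Subsingleton.elim i j]
    exact (Matrix.one_apply_eq j).symm
  map_comp r s := Matrix.ext fun i j =>
    (by simp [Matrix.mul_apply] : s * r = ((Matrix.of fun _ _ => s : Matrix (Fin 1) (Fin 1) A) *
      (Matrix.of fun _ _ => r : Matrix (Fin 1) (Fin 1) A)) i j)

/-- The canonical functor `A ⟶ (mod-(mod-A))ᵒᵖ`, `A ↦ Hom(A, -)`. -/
abbrev ringToFPFun : SingleObj A ⥤ (FPFun A)ᵒᵖ :=
  ringToMat A ⋙ MatObj.toMod A ⋙ FPMod.toFPFun A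

/-- The canonical functor from `A` to Adelman's category, `A ↦ (0 ⟶ A ⟶ 0)`. -/
abbrev ringToAdelman : SingleObj A ⥤ Adelman (MatObj A) :=
  ringToMat A ⋙ MatObj.toAdelman A

end Ring

end

/-! A chain `Z = (u, v)` is sent to the functor `H(Z, -)` of maps `A^n ⟶ M` killing `u`, modulo
those among them that factor through `v`. Since `v u` need not vanish, a map through `v` need not
kill `u`, hence the intersection with the cocycles in `ChainCohomology`. This functor on Adelman's
category plays the role of `𝔨⁻¹`; once it is known to be full, faithful and essentially surjective,
`𝔨` is a quasi-inverse.

Let `p : A^n ⟶ X` and `q : A^r ⟶ Y` be cokernels of `u` and `v u`, and `f : X ⟶ Y` the map induced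
by `v`. Cocycles are maps out of `X`, and the trivial ones are those that extend along `f`, so `H(Z,
-)` is the cokernel of `Hom(f, -)` (`rightExact_homFromToCohomology`). This is the formula for
`𝔨⁻¹`.

By Yoneda, a transformation out of `H(Z, -)` is determined by its value on the class of `p`.
Projectivity of free modules turns such values, and equalities between them, into matrices: this
gives faithfulness (`chainToFPFun_map_eq_iff`) and fullness. For essential surjectivity, a map of
free presentations of `f` is enlarged by `A^k` to the block chain, whose two cokernels are again `X`
and `Y` with induced map `f` (`FreeDiagram.block`). Uniqueness of cokernels then gives the formula
for `𝔨`. -/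

/-! ### Cohomology of three-term chains -/

section ChainCohomology

variable {C : Type*} [Category C] {D : Type*} [Category.{u} D] [Preadditive D] (P : C ⥤ D)

/-- The maps `P X₂ ⟶ M` vanishing on `P X₁`. -/
def chainCocycles (X : Chain3 C) (M : D) : AddSubgroup (P.obj X.X₂ ⟶ M) :=
  (Preadditive.leftComp M (P.map X.f₁)).ker

/-- The maps `P X₂ ⟶ M` factoring through `P X₃`. -/
def chainCoboundaries (X : Chain3 C) (M : D) : AddSubgroup (P.obj X.X₂ ⟶ M) :=
  (Preadditive.leftComp M (P.map X.f₂)).range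

/-- The maps `P X₂ ⟶ M` vanishing on `P X₁`, modulo those which factor through `P X₃`. -/
abbrev ChainCohomology (X : Chain3 C) (M : D) : Type u :=
  chainCocycles P X M ⧸ (chainCoboundaries P X M).addSubgroupOf (chainCocycles P X M)

namespace ChainCohomology

variable {P} {X Y Z : Chain3 C} {M N L : D}

/-- The class of a map `P X₂ ⟶ M` which vanishes on `P X₁`. -/
def mk (x : P.obj X.X₂ ⟶ M) (hx : P.map X.f₁ ≫ x = 0) : ChainCohomology P X M :=
  QuotientAddGroup.mk ⟨x, hx⟩

lemma exists_mk_eq (c : ChainCohomology P X M) : ∃ x hx, mk x hx = c := by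
  obtain ⟨⟨x, hx⟩, rfl⟩ := QuotientAddGroup.mk_surjective c
  exact ⟨x, hx, rfl⟩

lemma mk_add (x y : P.obj X.X₂ ⟶ M) (hx : P.map X.f₁ ≫ x = 0) (hy : P.map X.f₁ ≫ y = 0) :
    mk x hx + mk y hy = mk (x + y) (by rw [Preadditive.comp_add, hx, hy, add_zero]) := rfl

lemma mk_eq_zero_iff (x : P.obj X.X₂ ⟶ M) (hx : P.map X.f₁ ≫ x = 0) :
    mk x hx = 0 ↔ ∃ z : P.obj X.X₃ ⟶ M, P.map X.f₂ ≫ z = x :=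
  (QuotientAddGroup.eq_zero_iff _).trans Iff.rfl

lemma mk_eq_mk_iff (x y : P.obj X.X₂ ⟶ M) (hx : P.map X.f₁ ≫ x = 0) (hy : P.map X.f₁ ≫ y = 0) :
    mk x hx = mk y hy ↔ ∃ z : P.obj X.X₃ ⟶ M, P.map X.f₂ ≫ z = x - y := by
  rw [← sub_eq_zero, ← mk_eq_zero_iff (x - y) (by rw [Preadditive.comp_sub, hx, hy, sub_zero])]
  rfl

lemma mk_congr {x y : P.obj X.X₂ ⟶ M} (h : x = y) (hx : P.map X.f₁ ≫ x = 0) :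
    mk x hx = mk y (h ▸ hx) := by
  subst h; rfl

lemma comp_cocycle (φ : X ⟶ Y) (g : M ⟶ N) {x : P.obj Y.X₂ ⟶ M} (hx : P.map Y.f₁ ≫ x = 0) :
    P.map X.f₁ ≫ P.map φ.α₂ ≫ x ≫ g = 0 := by
  rw [← Category.assoc, ← P.map_comp, φ.comm₁, P.map_comp, Category.assoc,
    reassoc_of% hx, Limits.zero_comp, Limits.comp_zero]

/-- The map induced on classes by a map of chains and a map of coefficients. -/
def map (φ : X ⟶ Y) (g : M ⟶ N) : ChainCohomology P Y M →+ ChainCohomology P X N :=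
  QuotientAddGroup.map _ _
    ((((Preadditive.leftComp N (P.map φ.α₂)).comp (Preadditive.rightComp _ g)).comp
      (chainCocycles P Y M).subtype).codRestrict (chainCocycles P X N)
        fun x => comp_cocycle φ g x.2) (by
      rintro ⟨_, hx⟩ ⟨z, rfl⟩
      refine ⟨P.map φ.α₃ ≫ z ≫ g, ?_⟩
      change P.map X.f₂ ≫ P.map φ.α₃ ≫ z ≫ g = P.map φ.α₂ ≫ (P.map Y.f₂ ≫ z) ≫ g
      rw [← Category.assoc, ← P.map_comp, φ.comm₂, P.map_comp]
      simp only [Category.assoc])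

lemma map_mk (φ : X ⟶ Y) (g : M ⟶ N) (x : P.obj Y.X₂ ⟶ M) (hx : P.map Y.f₁ ≫ x = 0) :
    map φ g (mk x hx) = mk (P.map φ.α₂ ≫ x ≫ g) (comp_cocycle φ g hx) := rfl

lemma map_id (c : ChainCohomology P X M) : map (𝟙 X) (𝟙 M) c = c := by
  obtain ⟨x, hx, rfl⟩ := exists_mk_eq c
  rw [map_mk]
  exact mk_congr (by simp) _

lemma map_map (φ : X ⟶ Y) (ψ : Y ⟶ Z) (g : M ⟶ N) (h : N ⟶ L) (c : ChainCohomology P Z M) :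
    map φ h (map ψ g c) = map (φ ≫ ψ) (g ≫ h) c := by
  obtain ⟨x, hx, rfl⟩ := exists_mk_eq c
  simp only [map_mk]
  exact mk_congr (by simp) _

lemma map_add_left [Preadditive C] [P.Additive] (φ ψ : X ⟶ Y) (g : M ⟶ N)
    (c : ChainCohomology P Y M) : map (φ + ψ) g c = map φ g c + map ψ g c := by
  obtain ⟨x, hx, rfl⟩ := exists_mk_eq c
  simp only [map_mk, mk_add]
  exact mk_congr (by simp) _

/-- In a null-homotopy, the `s` part passes through the first map of `Y` and is killed by a cocycle,
while the `t` part passes through the second map of `X` and contributes a coboundary. -/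
lemma map_eq_of_homotopic [Preadditive C] [P.Additive] {φ ψ : X ⟶ Y}
    (h : Chain3.homotopic C φ ψ) (g : M ⟶ N) (c : ChainCohomology P Y M) :
    map φ g c = map ψ g c := by
  obtain ⟨x, hx, rfl⟩ := exists_mk_eq c
  obtain ⟨s, t, hst⟩ := (Chain3.homotopic_iff _ _).1 h
  simp only [map_mk, mk_eq_mk_iff]
  refine ⟨P.map t ≫ x ≫ g, ?_⟩
  rw [hst]
  simp [reassoc_of% hx]

end ChainCohomology

/-- The functor `M ↦ ChainCohomology P X M`. -/
def chainCohomologyFunctor (X : Chain3 C) : D ⥤ AddCommGrpCat.{u} where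
  obj M := AddCommGrpCat.of (ChainCohomology P X M)
  map g := AddCommGrpCat.ofHom (ChainCohomology.map (𝟙 X) g)
  map_id M := AddCommGrpCat.hom_ext (AddMonoidHom.ext fun c => ChainCohomology.map_id c)
  map_comp g h := by
    refine AddCommGrpCat.hom_ext (AddMonoidHom.ext fun c => ?_)
    refine Eq.symm ((ChainCohomology.map_map (𝟙 X) (𝟙 X) g h c).trans ?_)
    rw [Category.comp_id]; rfl

/-- The natural transformation of cohomology functors induced by a map of chains. -/
def chainCohomologyMap {X Y : Chain3 C} (φ : X ⟶ Y) :
    chainCohomologyFunctor P Y ⟶ chainCohomologyFunctor P X where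
  app M := AddCommGrpCat.ofHom (ChainCohomology.map φ (𝟙 M))
  naturality M N g := by
    refine AddCommGrpCat.hom_ext (AddMonoidHom.ext fun c => ?_)
    refine (ChainCohomology.map_map φ (𝟙 Y) g (𝟙 N) c).trans
      (Eq.trans ?_ (ChainCohomology.map_map (𝟙 X) φ (𝟙 M) g c).symm)
    simp only [Category.comp_id, Category.id_comp]

end ChainCohomology

/-! ### Maps between free modules and finitely presented modules -/

section Free

variable {A : Type u} [Ring A]

instance : (MatObj.toMod A).Additive where
  map_add {X Y U V} := by
    ext : 2
    exact LinearMap.ext fun x => Matrix.add_mulVec U V x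

/-- Column vectors over `A`, as a free right module. -/
def columnEquiv (n : ℕ) : (Fin n → A) ≃ₗ[Aᵐᵒᵖ] (Fin n → Aᵐᵒᵖ) where
  toFun x i := MulOpposite.op (x i)
  invFun x i := MulOpposite.unop (x i)
  map_add' _ _ := rfl
  map_smul' _ _ := rfl
  left_inv _ := rfl
  right_inv _ := rfl

instance projective_free (n : ℕ) : Module.Projective Aᵐᵒᵖ (Fin n → A) :=
  Module.Projective.of_equiv' (columnEquiv n).symm

/-- `A^m ⟶ A^n ⟶ X ⟶ 0` is exact. -/
structure FreePresentation {m n : MatObj A} (a : m ⟶ n) {X : FPMod A}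
    (p : (MatObj.toMod A).obj n ⟶ X) : Prop where
  exact : Function.Exact (matLin a) p.hom.hom
  surjective : Function.Surjective p.hom.hom

namespace FreePresentation

variable {m n : MatObj A} {a : m ⟶ n} {X M : FPMod A} {p : (MatObj.toMod A).obj n ⟶ X}

lemma comp_eq_zero (h : FreePresentation a p) : (MatObj.toMod A).map a ≫ p = 0 := by
  ext : 2
  exact LinearMap.ext fun x => h.exact.apply_apply_eq_zero x

lemma exists_desc (h : FreePresentation a p) (g : (MatObj.toMod A).obj n ⟶ M)
    (hg : (MatObj.toMod A).map a ≫ g = 0) : ∃ g' : X ⟶ M, p ≫ g' = g := by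
  have hker : LinearMap.ker p.hom.hom ≤ LinearMap.ker g.hom.hom := by
    intro x hx
    obtain ⟨y, rfl⟩ := (h.exact x).1 hx
    exact congrArg (fun k => k.hom.hom y) hg
  let e := p.hom.hom.quotKerEquivOfSurjective h.surjective
  refine ⟨ObjectProperty.homMk (ModuleCat.ofHom
    ((LinearMap.ker p.hom.hom).liftQ g.hom.hom hker ∘ₗ e.symm.toLinearMap)), ?_⟩
  ext x
  have : e.symm (p.hom.hom x) = Submodule.Quotient.mk x := by
    rw [LinearEquiv.symm_apply_eq]; rfl
  exact (congrArg ((LinearMap.ker p.hom.hom).liftQ g.hom.hom hker) this)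

lemma hom_ext (h : FreePresentation a p) {g g' : X ⟶ M} (hg : p ≫ g = p ≫ g') : g = g' := by
  ext x
  obtain ⟨y, rfl⟩ := h.surjective x
  exact congrArg (fun k => k.hom.hom y) hg

lemma exists_lift (h : FreePresentation a p) {k : MatObj A} (g : (MatObj.toMod A).obj k ⟶ X) :
    ∃ U : k ⟶ n, (MatObj.toMod A).map U ≫ p = g := by
  have : Module.Projective Aᵐᵒᵖ ((MatObj.toMod A).obj k).obj := projective_free k.n
  obtain ⟨g', hg'⟩ := Module.projective_lifting_property p.hom.hom g.hom.hom h.surjective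
  obtain ⟨U, hU⟩ := (MatObj.toMod A).map_surjective
    (ObjectProperty.homMk (ModuleCat.ofHom g') : (MatObj.toMod A).obj k ⟶ _)
  refine ⟨U, ?_⟩
  rw [hU]
  ext : 2
  exact hg'

/-- By exactness `V` lands in the image of `a`, and the free source lifts along the surjection onto
that image. Fullness of `MatObj.toMod` makes the lift a matrix, faithfulness makes the identity one
of matrices. -/
lemma exists_lift_of_comp_eq_zero (h : FreePresentation a p) {k : MatObj A} (V : k ⟶ n)
    (hV : (MatObj.toMod A).map V ≫ p = 0) : ∃ U : k ⟶ m, U ≫ a = V := by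
  obtain ⟨g', hg'⟩ := Module.projective_lifting_property
    (matLin a).rangeRestrict ((matLin V).codRestrict (LinearMap.range (matLin a)) fun x =>
      (h.exact _).1 (congrArg (fun k => k.hom.hom x) hV)) (LinearMap.surjective_rangeRestrict _)
  obtain ⟨U, hU⟩ := (MatObj.toMod A).map_surjective
    (ObjectProperty.homMk (ModuleCat.ofHom g') :
      (MatObj.toMod A).obj k ⟶ (MatObj.toMod A).obj m)
  refine ⟨U, (MatObj.toMod A).map_injective ?_⟩
  rw [Functor.map_comp, hU]
  ext x
  exact congrArg Subtype.val (LinearMap.congr_fun hg' x)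

end FreePresentation

/-- Every matrix has a finitely presented cokernel. -/
lemma exists_freePresentation_of_hom {m n : MatObj A} (a : m ⟶ n) :
    ∃ (X : FPMod A) (p : (MatObj.toMod A).obj n ⟶ X), FreePresentation a p := by
  have hX : Module.FinitePresentation Aᵐᵒᵖ ((Fin n.n → A) ⧸ LinearMap.range (matLin a)) := by
    refine Module.finitePresentation_of_surjective (Submodule.mkQ _)
      (Submodule.mkQ_surjective _) ?_
    rw [Submodule.ker_mkQ]
    exact Submodule.fg_range _
  refine ⟨⟨ModuleCat.of _ ((Fin n.n → A) ⧸ LinearMap.range (matLin a)), hX⟩,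
    ObjectProperty.homMk (ModuleCat.ofHom (Submodule.mkQ _)), ?_, Submodule.mkQ_surjective _⟩
  exact LinearMap.exact_map_mkQ_range _

/-- Every finitely generated right module is a quotient of some `A^n`. -/
lemma exists_surjective_of_finite (M : Type*) [AddCommGroup M] [Module Aᵐᵒᵖ M]
    [Module.Finite Aᵐᵒᵖ M] :
    ∃ (n : ℕ) (g : (Fin n → A) →ₗ[Aᵐᵒᵖ] M), Function.Surjective g := by
  obtain ⟨n, g, hg⟩ := Module.Finite.exists_fin' Aᵐᵒᵖ M
  exact ⟨n, g ∘ₗ (columnEquiv n).toLinearMap, hg.comp (columnEquiv n).surjective⟩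

/-- Every finitely presented module has a free presentation. -/
lemma exists_freePresentation (X : FPMod A) : ∃ (m n : MatObj A) (a : m ⟶ n)
    (p : (MatObj.toMod A).obj n ⟶ X), FreePresentation a p := by
  have : Module.FinitePresentation Aᵐᵒᵖ X.obj := X.property
  obtain ⟨n, p, hp⟩ := exists_surjective_of_finite (A := A) X.obj
  -- Finite presentation makes the relations finitely generated, so a second free cover supplies the
  -- matrix `a`.
  have : Module.Finite Aᵐᵒᵖ (LinearMap.ker p) :=
    Module.Finite.iff_fg.2 (Module.FinitePresentation.fg_ker p hp)
  obtain ⟨m, g, hg⟩ := exists_surjective_of_finite (A := A) (LinearMap.ker p)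
  obtain ⟨a, ha⟩ := (MatObj.toMod A).map_surjective
    (ObjectProperty.homMk (ModuleCat.ofHom ((LinearMap.ker p).subtype ∘ₗ g)) :
      (MatObj.toMod A).obj ⟨m⟩ ⟶ (MatObj.toMod A).obj ⟨n⟩)
  have ha' : matLin a = (LinearMap.ker p).subtype ∘ₗ g := congrArg (fun k => k.hom.hom) ha
  refine ⟨⟨m⟩, ⟨n⟩, a, ObjectProperty.homMk (ModuleCat.ofHom p), ?_, hp⟩
  rw [ha']
  intro x
  constructor
  · intro hx
    obtain ⟨y, hy⟩ := hg ⟨x, hx⟩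
    exact ⟨y, congrArg Subtype.val hy⟩
  · rintro ⟨y, rfl⟩
    exact (g y).2

end Free

/-! ### The functor from Adelman's category to finitely presented functors -/

section Adelman

variable {A : Type u} [Ring A]

/-- Any matrix chain `u, v` gives a map between the cokernels of `u` and `v u`. -/
lemma exists_cokernel_map (Z : Chain3 (MatObj A)) : ∃ (X Y : FPMod A) (f : X ⟶ Y)
    (p : (MatObj.toMod A).obj Z.X₂ ⟶ X) (q : (MatObj.toMod A).obj Z.X₃ ⟶ Y),
    FreePresentation Z.f₁ p ∧ FreePresentation (Z.f₁ ≫ Z.f₂) q ∧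
      p ≫ f = (MatObj.toMod A).map Z.f₂ ≫ q := by
  obtain ⟨X, p, hp⟩ := exists_freePresentation_of_hom Z.f₁
  obtain ⟨Y, q, hq⟩ := exists_freePresentation_of_hom (Z.f₁ ≫ Z.f₂)
  obtain ⟨f, hf⟩ := hp.exists_desc ((MatObj.toMod A).map Z.f₂ ≫ q) (by
    rw [← Category.assoc, ← Functor.map_comp, hq.comp_eq_zero])
  exact ⟨X, Y, f, p, q, hp, hq, hf⟩

/-- The map `Hom(X, -) ⟶ H(Z, -)`, `g ↦ [p g]`, for `p : A^n ⟶ X` vanishing on the image of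
the first matrix of the chain `Z`. -/
def homFromToCohomology (Z : Chain3 (MatObj A)) {X : FPMod A}
    (p : (MatObj.toMod A).obj Z.X₂ ⟶ X) (hp : (MatObj.toMod A).map Z.f₁ ≫ p = 0) :
    homFrom X ⟶ chainCohomologyFunctor (MatObj.toMod A) Z where
  app M := AddCommGrpCat.ofHom
    { toFun := fun g : X ⟶ M => ChainCohomology.mk (p ≫ g) (by
        rw [reassoc_of% hp, Limits.zero_comp])
      map_zero' := (ChainCohomology.mk_eq_zero_iff _ _).2 ⟨0, by rw [Limits.comp_zero]; exact (Limits.comp_zero).symm⟩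
      map_add' := fun g h => by
        rw [ChainCohomology.mk_add]
        exact ChainCohomology.mk_congr (Preadditive.comp_add _ _ _ _ _ _) _ }
  naturality M N k := by
    refine AddCommGrpCat.hom_ext (AddMonoidHom.ext fun (g : X ⟶ M) => ?_)
    change ChainCohomology.mk (p ≫ g ≫ k) _ = ChainCohomology.map (𝟙 Z) k (.mk (p ≫ g) _)
    rw [ChainCohomology.map_mk]
    exact ChainCohomology.mk_congr (by simp) _

lemma homFromToCohomology_app (Z : Chain3 (MatObj A)) {X M : FPMod A}
    (p : (MatObj.toMod A).obj Z.X₂ ⟶ X) (hp : (MatObj.toMod A).map Z.f₁ ≫ p = 0) (g : X ⟶ M) :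
    (homFromToCohomology Z p hp).app M g =
      ChainCohomology.mk (p ≫ g) (by rw [reassoc_of% hp, Limits.zero_comp]) := rfl

/-- The cohomology functor of `u, v` is presented by the map from the cokernel of `u` to the
cokernel of `v u`. -/
lemma rightExact_homFromToCohomology (Z : Chain3 (MatObj A)) {X Y : FPMod A} {f : X ⟶ Y}
    {p : (MatObj.toMod A).obj Z.X₂ ⟶ X} {q : (MatObj.toMod A).obj Z.X₃ ⟶ Y}
    (hp : FreePresentation Z.f₁ p) (hq : FreePresentation (Z.f₁ ≫ Z.f₂) q)
    (hf : p ≫ f = (MatObj.toMod A).map Z.f₂ ≫ q) :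
    RightExact (homFromMap f) (homFromToCohomology Z p hp.comp_eq_zero) := by
  refine fun M => ⟨fun (g : X ⟶ M) => ?_, fun c => ?_⟩
  · rw [homFromToCohomology_app]
    refine (ChainCohomology.mk_eq_zero_iff _ _).trans ⟨?_, ?_⟩
    · rintro ⟨z, hz⟩
      -- This is why `Y` is the cokernel of the composite: `z` need not kill `Z.f₂`, but `Z.f₂ ≫ z =
      -- p ≫ g` is killed by `Z.f₁`.
      obtain ⟨y, rfl⟩ := hq.exists_desc z (by
        rw [Functor.map_comp, Category.assoc, hz, reassoc_of% hp.comp_eq_zero, Limits.zero_comp])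
      exact ⟨y, hp.hom_ext (by
        change p ≫ f ≫ y = p ≫ g
        rw [reassoc_of% hf, hz])⟩
    · rintro ⟨y, rfl⟩
      exact ⟨q ≫ (y : Y ⟶ M), ((reassoc_of% hf) (y : Y ⟶ M)).symm⟩
  · obtain ⟨x, hx, rfl⟩ := ChainCohomology.exists_mk_eq c
    obtain ⟨g, rfl⟩ := hp.exists_desc x hx
    exact ⟨g, rfl⟩

lemma isFPFunctor_chainCohomologyFunctor (Z : Chain3 (MatObj A)) :
    isFPFunctor A (chainCohomologyFunctor (MatObj.toMod A) Z) := by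
  obtain ⟨X, Y, f, p, q, hp, hq, hf⟩ := exists_cokernel_map Z
  exact ⟨X, Y, _, _, rightExact_homFromToCohomology Z hp hq hf⟩

variable (A) in
/-- Cohomology as a functor from chains of matrices to finitely presented functors. -/
def chainToFPFun : Chain3 (MatObj A) ⥤ (FPFun A)ᵒᵖ where
  obj Z := op ⟨chainCohomologyFunctor (MatObj.toMod A) Z, isFPFunctor_chainCohomologyFunctor Z⟩
  map φ := (ObjectProperty.homMk (chainCohomologyMap (MatObj.toMod A) φ)).op
  map_id Z := by
    apply Quiver.Hom.unop_inj
    ext M : 3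
    exact AddCommGrpCat.hom_ext (AddMonoidHom.ext fun c => ChainCohomology.map_id c)
  map_comp φ ψ := by
    apply Quiver.Hom.unop_inj
    ext M : 3
    refine AddCommGrpCat.hom_ext (AddMonoidHom.ext fun c => ?_)
    refine Eq.symm ((ChainCohomology.map_map φ ψ (𝟙 M) (𝟙 M) c).trans ?_)
    rw [Category.comp_id]; rfl

/-- Two morphisms in the image of `chainToFPFun` are equal if they agree on all classes. -/
lemma chainToFPFun_hom_ext {X Y : Chain3 (MatObj A)}
    {η θ : (chainToFPFun A).obj X ⟶ (chainToFPFun A).obj Y}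
    (h : ∀ (M : FPMod A) (c : ChainCohomology (MatObj.toMod A) Y M),
      η.unop.hom.app M c = θ.unop.hom.app M c) : η = θ := by
  apply Quiver.Hom.unop_inj
  ext M : 3
  exact AddCommGrpCat.hom_ext (AddMonoidHom.ext fun c => h M c)

lemma chainToFPFun_map_app {X Y : Chain3 (MatObj A)} (φ : X ⟶ Y) (M : FPMod A)
    (c : ChainCohomology (MatObj.toMod A) Y M) :
    ((chainToFPFun A).map φ).unop.hom.app M c = ChainCohomology.map φ (𝟙 M) c := rfl

instance : (chainToFPFun A).Additive where
  map_add := chainToFPFun_hom_ext fun M c => ChainCohomology.map_add_left _ _ (𝟙 M) c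

/-- The forward direction only needs the universal class, that of the cokernel `p` of `Y.f₁`.
Equality there says that the difference of the middle maps, followed by `p`, factors through `X.f₂`
via some `z`. A lift of `z` along `p` is `t`; what remains dies under `p`, so it factors through
`Y.f₁`, which gives `s`. -/
lemma chainToFPFun_map_eq_iff {X Y : Chain3 (MatObj A)} (φ ψ : X ⟶ Y) :
    (chainToFPFun A).map φ = (chainToFPFun A).map ψ ↔ Chain3.homotopic _ φ ψ := by
  refine ⟨fun h => ?_, fun h => chainToFPFun_hom_ext fun M c =>
    ChainCohomology.map_eq_of_homotopic h (𝟙 M) c⟩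
  obtain ⟨K, p, hp⟩ := exists_freePresentation_of_hom Y.f₁
  have h₁ : ChainCohomology.map φ (𝟙 K) (.mk p hp.comp_eq_zero) =
      ChainCohomology.map ψ (𝟙 K) (.mk p hp.comp_eq_zero) := by
    rw [← chainToFPFun_map_app, h, chainToFPFun_map_app]
  rw [ChainCohomology.map_mk, ChainCohomology.map_mk, ChainCohomology.mk_eq_mk_iff] at h₁
  obtain ⟨z, hz⟩ := h₁
  obtain ⟨t, rfl⟩ := hp.exists_lift z
  obtain ⟨s, hs⟩ := hp.exists_lift_of_comp_eq_zero (φ.α₂ - ψ.α₂ - X.f₂ ≫ t) (by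
    simp only [Functor.map_sub, Functor.map_comp, Preadditive.sub_comp, Category.assoc, hz,
      Category.comp_id, sub_self])
  exact (Chain3.homotopic_iff _ _).2 ⟨s, t, by rw [hs]; abel⟩

instance : (chainToFPFun A).Full where
  map_surjective {X Y} η := by
    obtain ⟨K, L, f, p, q, hp, hq, hf⟩ := exists_cokernel_map Y
    have nat : ∀ {M N : FPMod A} (g : M ⟶ N) (c : ChainCohomology (MatObj.toMod A) Y M),
        η.unop.hom.app N (ChainCohomology.map (𝟙 Y) g c) =
          ChainCohomology.map (𝟙 X) g (η.unop.hom.app M c) := fun g c =>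
      NatTrans.naturality_apply (φ := η.unop.hom) g c
    -- Yoneda: `x` represents the image of the universal class, and its lift along `p` is a first
    -- candidate for the middle matrix.
    obtain ⟨x, hx, hηx⟩ := ChainCohomology.exists_mk_eq
      (η.unop.hom.app K (ChainCohomology.mk p hp.comp_eq_zero) :
        ChainCohomology (MatObj.toMod A) X K)
    obtain ⟨α₂, rfl⟩ := hp.exists_lift x
    obtain ⟨α₁, h₁⟩ := hp.exists_lift_of_comp_eq_zero (X.f₁ ≫ α₂) (by
      rw [Functor.map_comp, Category.assoc, hx])
    -- Pushed along `f`, the universal class becomes that of `p ≫ f`, a coboundary through `q`. By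
    -- naturality its image under `η` also vanishes, and the witness lifts to `α₃`.
    have hz : ChainCohomology.map (𝟙 X) f (.mk ((MatObj.toMod A).map α₂ ≫ p) hx) = 0 := by
      rw [hηx, ← nat, ChainCohomology.map_mk, (ChainCohomology.mk_eq_zero_iff _ _).2]
      · exact map_zero (η.unop.hom.app L).hom
      · exact ⟨q, by simp [hf]⟩
    rw [ChainCohomology.map_mk, ChainCohomology.mk_eq_zero_iff] at hz
    obtain ⟨z, hz⟩ := hz
    obtain ⟨α₃, rfl⟩ := hq.exists_lift z
    -- The right square commutes only after `q`; its defect is `w ≫ Y.f₁ ≫ Y.f₂`. Adding `w ≫ Y.f₁`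
    -- to `α₂` and `X.f₁ ≫ w` to `α₁` repairs it, keeps the left square, and leaves `α₂ ≫ p`
    -- unchanged in `mod-A`.
    obtain ⟨w, hw⟩ := hq.exists_lift_of_comp_eq_zero (X.f₂ ≫ α₃ - α₂ ≫ Y.f₂) (by
      simp only [Functor.map_sub, Functor.map_comp, Preadditive.sub_comp, Category.assoc, hz, ← hf]
      simp)
    refine ⟨⟨α₁ + X.f₁ ≫ w, α₂ + w ≫ Y.f₁, α₃, by simp [h₁], by simp [hw]⟩, ?_⟩
    refine chainToFPFun_hom_ext fun M c => ?_
    obtain ⟨g, hg, rfl⟩ := ChainCohomology.exists_mk_eq c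
    obtain ⟨g, rfl⟩ := hp.exists_desc g hg
    -- Every class is a pushforward of the universal one, so agreement there suffices.
    have h₂ : ChainCohomology.mk (p ≫ g) hg =
        ChainCohomology.map (𝟙 Y) g (.mk p hp.comp_eq_zero) := by
      rw [ChainCohomology.map_mk]
      exact ChainCohomology.mk_congr (by simp) _
    rw [chainToFPFun_map_app, ChainCohomology.map_mk, h₂, nat, ← hηx, ChainCohomology.map_mk]
    exact ChainCohomology.mk_congr (by simp [reassoc_of% hp.comp_eq_zero]) _

variable (A) in
/-- Cohomology as a functor from Adelman's category to finitely presented functors. -/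
def adelmanToFPFun : Adelman (MatObj A) ⥤ (FPFun A)ᵒᵖ :=
  CategoryTheory.Quotient.lift _ (chainToFPFun A) fun _ _ _ _ h => (chainToFPFun_map_eq_iff _ _).2 h

instance : (adelmanToFPFun A).Additive where
  map_add {X Y φ ψ} := by
    obtain ⟨φ, rfl⟩ := (Quotient.functor _).map_surjective φ
    obtain ⟨ψ, rfl⟩ := (Quotient.functor _).map_surjective ψ
    exact (chainToFPFun A).map_add (f := φ) (g := ψ)

instance : (adelmanToFPFun A).Full where
  map_surjective {X Y} η := by
    obtain ⟨φ, hφ⟩ := (chainToFPFun A).map_surjective η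
    exact ⟨(Quotient.functor _).map φ, hφ⟩

instance : (adelmanToFPFun A).Faithful where
  map_injective {X Y φ ψ} h := by
    obtain ⟨φ, rfl⟩ := (Quotient.functor _).map_surjective φ
    obtain ⟨ψ, rfl⟩ := (Quotient.functor _).map_surjective ψ
    exact CategoryTheory.Quotient.sound _ ((chainToFPFun_map_eq_iff φ ψ).1 h)

/-! ### Presentations -/

/-- Cokernels are computed pointwise; surjectivity of `π` reduces naturality of the descended maps
to that of `π` and `π'`. -/
lemma RightExact.exists_desc {G H F F' : FPMod A ⥤ AddCommGrpCat.{u}} {φ : G ⟶ H} {π : H ⟶ F}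
    (h : RightExact φ π) (π' : H ⟶ F') (hπ' : φ ≫ π' = 0) : ∃ ψ : F ⟶ F', π ≫ ψ = π' := by
  have hker (M : FPMod A) : (π.app M).hom.ker ≤ (π'.app M).hom.ker := by
    intro x hx
    obtain ⟨y, rfl⟩ := ((h M).1 x).1 hx
    exact congrArg (fun k : G ⟶ F' => k.app M y) hπ'
  let ψ (M : FPMod A) : F.obj M →+ F'.obj M :=
    AddMonoidHom.liftOfSurjective (π.app M).hom (h M).2 ⟨(π'.app M).hom, hker M⟩
  have hψ (M : FPMod A) (x : H.obj M) : ψ M (π.app M x) = π'.app M x :=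
    AddMonoidHom.liftOfRightInverse_comp_apply _ _ _ _ x
  refine ⟨⟨fun M => AddCommGrpCat.ofHom (ψ M), fun M N g => ?_⟩, ?_⟩
  · refine AddCommGrpCat.hom_ext (AddMonoidHom.ext fun x => ?_)
    obtain ⟨y, rfl⟩ := (h M).2 x
    change ψ N (F.map g (π.app M y)) = F'.map g (ψ M (π.app M y))
    rw [hψ, ← NatTrans.naturality_apply, ← NatTrans.naturality_apply, hψ]
  · ext M : 2
    exact AddCommGrpCat.hom_ext (AddMonoidHom.ext fun x => hψ M x)

lemma RightExact.epi {G H F : FPMod A ⥤ AddCommGrpCat.{u}} {φ : G ⟶ H} {π : H ⟶ F}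
    (h : RightExact φ π) : Epi π :=
  have (M : FPMod A) : Epi (π.app M) := (AddCommGrpCat.epi_iff_surjective _).2 (h M).2
  NatTrans.epi_of_epi_app π

lemma RightExact.comp_eq_zero {G H F : FPMod A ⥤ AddCommGrpCat.{u}} {φ : G ⟶ H} {π : H ⟶ F}
    (h : RightExact φ π) : φ ≫ π = 0 := by
  ext M : 2
  exact AddCommGrpCat.hom_ext (AddMonoidHom.ext fun x => (h M).1.apply_apply_eq_zero x)

lemma RightExact.nonempty_iso {G H F F' : FPMod A ⥤ AddCommGrpCat.{u}} {φ : G ⟶ H} {π : H ⟶ F}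
    {π' : H ⟶ F'} (h : RightExact φ π) (h' : RightExact φ π') : Nonempty (F ≅ F') := by
  obtain ⟨ψ, hψ⟩ := h.exists_desc π' h'.comp_eq_zero
  obtain ⟨ψ', hψ'⟩ := h'.exists_desc π h.comp_eq_zero
  have := h.epi
  have := h'.epi
  exact ⟨ψ, ψ', by rw [← cancel_epi π, reassoc_of% hψ, hψ', Category.comp_id],
    by rw [← cancel_epi π', reassoc_of% hψ', hψ, Category.comp_id]⟩

lemma ProjPresentation.nonempty_iso {X Y : FPMod A} {f : X ⟶ Y} {F F' : FPFun A}
    (h : ProjPresentation f F) (h' : ProjPresentation f F') : Nonempty (F ≅ F') := by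
  obtain ⟨e⟩ := h.exact.nonempty_iso h'.exact
  exact ⟨(isFPFunctor A).isoMk e⟩

lemma exists_projPresentation (F : FPFun A) :
    ∃ (X Y : FPMod A) (f : X ⟶ Y), Nonempty (ProjPresentation f F) := by
  obtain ⟨X, Y, φ, π, h⟩ := F.property
  obtain ⟨f, rfl⟩ := preadditiveCoyoneda.map_surjective φ
  exact ⟨X, Y, f.unop, ⟨π, h⟩⟩

lemma exists_freeDiagram {X Y : FPMod A} (f : X ⟶ Y) :
    ∃ (m n k l : ℕ) (a : Matrix (Fin n) (Fin m) A) (b : Matrix (Fin k) (Fin m) A)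
      (c : Matrix (Fin l) (Fin n) A) (d : Matrix (Fin l) (Fin k) A),
      Nonempty (FreeDiagram a b c d f) := by
  obtain ⟨m, n, a, p, hp⟩ := exists_freePresentation X
  obtain ⟨k, l, d, q, hq⟩ := exists_freePresentation Y
  obtain ⟨c, hc⟩ := hq.exists_lift (p ≫ f)
  obtain ⟨b, hb⟩ := hq.exists_lift_of_comp_eq_zero (a ≫ c) (by
    rw [Functor.map_comp, Category.assoc, hc, reassoc_of% hp.comp_eq_zero, Limits.zero_comp])
  exact ⟨m.n, n.n, k.n, l.n, a, b, c, d,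
    ⟨p, q, hp.exact, hp.surjective, hq.exact, hq.surjective, hb.symm, hc.symm⟩⟩

lemma exists_freeDiagram_of_chain {m n r : ℕ} (u : Matrix (Fin n) (Fin m) A)
    (v : Matrix (Fin r) (Fin n) A) :
    ∃ (X Y : FPMod A) (f : X ⟶ Y), Nonempty (FreeDiagram u 1 v (v * u) f) := by
  obtain ⟨X, Y, f, p, q, hp, hq, hf⟩ := exists_cokernel_map (matChain u v).as
  exact ⟨X, Y, f, ⟨p, q, hp.exact, hp.surjective, hq.exact, hq.surjective,
    (Matrix.mul_one _).symm, hf⟩⟩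

/-- The finitely presented functor of a chain `u, v` is presented by any map induced by `v` from
the cokernel of `u` to the cokernel of `v u`. -/
lemma nonempty_projPresentation_of_chain {m n r : ℕ} {u : Matrix (Fin n) (Fin m) A}
    {v : Matrix (Fin r) (Fin n) A} {X Y : FPMod A} {f : X ⟶ Y}
    (D : FreeDiagram u 1 v (v * u) f) :
    Nonempty (ProjPresentation f ((adelmanToFPFun A).obj (matChain u v)).unop) :=
  ⟨⟨homFromToCohomology (matChain u v).as D.p
      (FreePresentation.comp_eq_zero ⟨D.exact_p, D.surjective_p⟩),
    rightExact_homFromToCohomology (matChain u v).as (f := f) (p := D.p) (q := D.q)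
    ⟨D.exact_p, D.surjective_p⟩ ⟨D.exact_q, D.surjective_q⟩ D.comm_right⟩⟩

end Adelman

section Equivalence

variable {A : Type u} [Ring A]

/-! ### The block chain of a map of free presentations -/

section Block

variable {m n k l : ℕ} (a : Matrix (Fin n) (Fin m) A) (b : Matrix (Fin k) (Fin m) A)
  (c : Matrix (Fin l) (Fin n) A) (d : Matrix (Fin l) (Fin k) A)

/-- The matrix `[[a, 0], [b, -1]]`. -/
abbrev blockMatrix : Matrix (Fin (n + k)) (Fin (m + k)) A :=
  (Matrix.fromBlocks a 0 b (-1 : Matrix (Fin k) (Fin k) A)).reindex finSumFinEquiv finSumFinEquiv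

/-- The matrix `[c, -d]`. -/
abbrev rowMatrix : Matrix (Fin l) (Fin (n + k)) A :=
  (Matrix.fromCols c (-d)).reindex (Equiv.refl (Fin l)) finSumFinEquiv

/-- Column vectors of length `m + n` as pairs of column vectors. -/
def appendEquiv (A : Type u) (m n : ℕ) : (Fin m → A) × (Fin n → A) ≃ (Fin (m + n) → A) :=
  (Equiv.sumArrowEquivProdArrow _ _ _).symm.trans (finSumFinEquiv.arrowCongr (Equiv.refl A))

lemma matLin_blockMatrix (y : (Fin m → A) × (Fin k → A)) :
    matLin (blockMatrix a b) (appendEquiv A m k y) =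
      appendEquiv A n k (matLin a y.1, matLin b y.1 - y.2) := by
  change Matrix.mulVec (blockMatrix a b) _ = _
  rw [blockMatrix, Matrix.reindex_apply, Matrix.submatrix_mulVec_equiv, Matrix.fromBlocks_mulVec]
  funext i
  refine Fin.addCases (fun i => ?_) (fun i => ?_) i <;>
    simp [appendEquiv, matLin, Function.comp_def, Matrix.neg_mulVec, sub_eq_add_neg] <;> rfl

lemma matLin_rowMatrix (x : (Fin n → A) × (Fin k → A)) :
    matLin (rowMatrix c d) (appendEquiv A n k x) = matLin c x.1 - matLin d x.2 := by
  change Matrix.mulVec (rowMatrix c d) _ = _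
  rw [rowMatrix, Matrix.reindex_apply, Matrix.submatrix_mulVec_equiv, Matrix.fromCols_mulVec]
  simp [appendEquiv, matLin, Function.comp_def, Matrix.neg_mulVec, sub_eq_add_neg]
  rfl

/-- The composite is `[c a - d b, d] = [0, d]`, so it has the same image as `d` and hence cokernel
`Y`. -/
lemma matLin_rowMatrix_mul_blockMatrix (h : c * a = d * b) (y : (Fin m → A) × (Fin k → A)) :
    matLin (rowMatrix c d * blockMatrix a b) (appendEquiv A m k y) = matLin d y.2 := by
  have hmul {m n k : ℕ} (U : Matrix (Fin n) (Fin m) A) (V : Matrix (Fin k) (Fin n) A)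
      (x : Fin m → A) : matLin (V * U) x = matLin V (matLin U x) :=
    (Matrix.mulVec_mulVec x V U).symm
  rw [hmul, matLin_blockMatrix, matLin_rowMatrix, map_sub, ← hmul, ← hmul, h]
  abel

variable {a b c d} {X Y : FPMod A} {f : X ⟶ Y}

/-- A map of free presentations exhibits its target map as the map induced by `[c, -d]` on the
cokernels of the block chain. -/
def FreeDiagram.block (D : FreeDiagram a b c d f) :
    FreeDiagram (blockMatrix a b) 1 (rowMatrix c d) (rowMatrix c d * blockMatrix a b) f where
  p := ObjectProperty.homMk (ModuleCat.ofHom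
    (D.p.hom.hom ∘ₗ LinearMap.funLeft Aᵐᵒᵖ A (Fin.castAdd k)))
  q := D.q
  exact_p x := by
    obtain ⟨⟨x₁, x₂⟩, rfl⟩ := (appendEquiv A n k).surjective x
    have h₁ : LinearMap.funLeft Aᵐᵒᵖ A (Fin.castAdd k) (appendEquiv A n k (x₁, x₂)) = x₁ := by
      funext i
      simp [appendEquiv, LinearMap.funLeft]
    change D.p.hom.hom (LinearMap.funLeft Aᵐᵒᵖ A (Fin.castAdd k) _) = 0 ↔ _
    rw [h₁]
    refine (D.exact_p x₁).trans ⟨?_, ?_⟩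
    · rintro ⟨y, rfl⟩
      -- The block `-1` makes the second coordinate arbitrary: solving `b y - y₂ = x₂` gives `y₂`.
      exact ⟨appendEquiv A m k (y, matLin b y - x₂), by rw [matLin_blockMatrix]; simp⟩
    · rintro ⟨y, hy⟩
      obtain ⟨y, rfl⟩ := (appendEquiv A m k).surjective y
      rw [matLin_blockMatrix] at hy
      exact ⟨y.1, congrArg Prod.fst ((appendEquiv A n k).injective hy)⟩
  surjective_p := D.surjective_p.comp
    (LinearMap.funLeft_surjective_of_injective _ _ _ (Fin.castAdd_injective n k))
  exact_q z := by
    refine (D.exact_q z).trans ⟨?_, ?_⟩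
    · rintro ⟨y, rfl⟩
      exact ⟨appendEquiv A m k (0, y), matLin_rowMatrix_mul_blockMatrix a b c d D.comm_left _⟩
    · rintro ⟨y, rfl⟩
      obtain ⟨y, rfl⟩ := (appendEquiv A m k).surjective y
      exact ⟨y.2, (matLin_rowMatrix_mul_blockMatrix a b c d D.comm_left y).symm⟩
  surjective_q := D.surjective_q
  comm_left := (Matrix.mul_one _).symm
  comm_right := by
    ext x
    obtain ⟨⟨x₁, x₂⟩, rfl⟩ := (appendEquiv A n k).surjective x
    have h₁ : LinearMap.funLeft Aᵐᵒᵖ A (Fin.castAdd k) (appendEquiv A n k (x₁, x₂)) = x₁ := by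
      funext i
      simp [appendEquiv, LinearMap.funLeft]
    change f.hom.hom (D.p.hom.hom (LinearMap.funLeft Aᵐᵒᵖ A (Fin.castAdd k) _)) =
      D.q.hom.hom (matLin (rowMatrix c d) _)
    rw [h₁, matLin_rowMatrix]
    refine (congrArg (fun g => g.hom.hom x₁) D.comm_right).trans
      (Eq.symm ((map_sub D.q.hom.hom _ _).trans ?_))
    -- The extra coordinate `x₂` enters only through `d x₂`, which `q` kills.
    rw [D.exact_q.apply_apply_eq_zero]
    exact sub_zero _

end Block

/-- The finitely presented functor of the block chain of a map of free presentations of `f` is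
the cokernel of `Hom(f, -)`. -/
lemma nonempty_obj_blockChain_iso {F : FPFun A} {X Y : FPMod A} {f : X ⟶ Y}
    (hF : ProjPresentation f F) {m n k l : ℕ} {a : Matrix (Fin n) (Fin m) A}
    {b : Matrix (Fin k) (Fin m) A} {c : Matrix (Fin l) (Fin n) A} {d : Matrix (Fin l) (Fin k) A}
    (D : FreeDiagram a b c d f) :
    Nonempty ((adelmanToFPFun A).obj (blockChain a b c d) ≅ op F) := by
  obtain ⟨h⟩ := nonempty_projPresentation_of_chain D.block
  obtain ⟨e⟩ := hF.nonempty_iso h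
  exact ⟨e.op⟩

instance : (adelmanToFPFun A).EssSurj where
  mem_essImage F := by
    obtain ⟨X, Y, f, ⟨h⟩⟩ := exists_projPresentation F.unop
    obtain ⟨m, n, k, l, a, b, c, d, ⟨D⟩⟩ := exists_freeDiagram f
    exact ⟨blockChain a b c d, nonempty_obj_blockChain_iso h D⟩

instance : (adelmanToFPFun A).IsEquivalence where

/-! ### Compatibility with the embeddings -/

lemma toMod_map_toChain_f₁ (X : MatObj A) :
    (MatObj.toMod A).map ((MatObj.toChain A).obj X).f₁ = 0 := Functor.map_zero _ _ _

lemma toMod_map_toChain_f₂ (X : MatObj A) :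
    (MatObj.toMod A).map ((MatObj.toChain A).obj X).f₂ = 0 := Functor.map_zero _ _ _

/-- The map `Hom(A^n, -) ⟶ H(0 ⟶ A^n ⟶ 0, -)`. -/
abbrev homFromToCohomologyToChain (X : MatObj A) :
    homFrom ((MatObj.toMod A).obj X) ⟶
      chainCohomologyFunctor (MatObj.toMod A) ((MatObj.toChain A).obj X) :=
  homFromToCohomology ((MatObj.toChain A).obj X) (𝟙 _)
    ((Category.comp_id _).trans (toMod_map_toChain_f₁ X))

/-- The cohomology functor of `0 ⟶ A^n ⟶ 0` is `Hom(A^n, -)`. -/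
lemma isIso_homFromToCohomology_toChain (X : MatObj A) :
    IsIso (homFromToCohomologyToChain X) := by
  have (M : FPMod A) : IsIso ((homFromToCohomologyToChain X).app M) := by
    refine (ConcreteCategory.isIso_iff_bijective _).2 ⟨?_, fun x => ?_⟩
    · refine (injective_iff_map_eq_zero _).2 fun (g : (MatObj.toMod A).obj X ⟶ M) hg => ?_
      obtain ⟨z, hz⟩ := (ChainCohomology.mk_eq_zero_iff _ _).1 hg
      refine (Category.id_comp g).symm.trans (hz.symm.trans ?_)
      -- Both maps of the chain vanish, so the only coboundary is `0`, and below every map is a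
      -- cocycle.
      rw [toMod_map_toChain_f₂, Limits.zero_comp]
      rfl
    · obtain ⟨x, hx, rfl⟩ := ChainCohomology.exists_mk_eq x
      exact ⟨x, ChainCohomology.mk_congr (Category.id_comp _) _⟩
  exact NatIso.isIso_of_isIso_app _

variable (A) in
/-- On chains `0 ⟶ A^n ⟶ 0`, the functor from Adelman's category is `A^n ↦ Hom(A^n, -)`. -/
noncomputable def toAdelmanCompIso :
    MatObj.toAdelman A ⋙ adelmanToFPFun A ≅ MatObj.toMod A ⋙ FPMod.toFPFun A :=
  NatIso.ofComponents
    (fun X =>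
      haveI := isIso_homFromToCohomology_toChain X
      ((isFPFunctor A).isoMk (X := ((FPMod.toFPFun A).obj ((MatObj.toMod A).obj X)).unop)
        (Y := ((chainToFPFun A).obj ((MatObj.toChain A).obj X)).unop)
        (@asIso _ _ _ _ (homFromToCohomologyToChain X) this)).op)
    (fun {X Y} U => by
      apply Quiver.Hom.unop_inj
      ext M : 3
      refine AddCommGrpCat.hom_ext (AddMonoidHom.ext
        fun (g : (MatObj.toMod A).obj Y ⟶ M) => ?_)
      change ChainCohomology.map ((MatObj.toChain A).map U) (𝟙 M) (.mk (𝟙 _ ≫ g) _) =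
        ChainCohomology.mk (𝟙 _ ≫ (MatObj.toMod A).map U ≫ g) _
      rw [ChainCohomology.map_mk]
      exact ChainCohomology.mk_congr (by simp [MatObj.toChain]) _)

end Equivalence

theorem theorem2p7 (A : Type u) [Ring A] :
    -- every finitely presented functor and every map in `mod-A` has presentations as required
    (∀ F : FPFun A, ∃ (X Y : FPMod A) (f : X ⟶ Y), Nonempty (ProjPresentation f F)) ∧
    (∀ (X Y : FPMod A) (f : X ⟶ Y), ∃ (m n k l : ℕ) (a : Matrix (Fin n) (Fin m) A)
      (b : Matrix (Fin k) (Fin m) A) (c : Matrix (Fin l) (Fin n) A) (d : Matrix (Fin l) (Fin k) A),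
      Nonempty (FreeDiagram a b c d f)) ∧
    (∀ (m n r : ℕ) (u : Matrix (Fin n) (Fin m) A) (v : Matrix (Fin r) (Fin n) A),
      ∃ (X Y : FPMod A) (f : X ⟶ Y), Nonempty (FreeDiagram u 1 v (v * u) f)) ∧
    ∃ e : (FPFun A)ᵒᵖ ≌ Adelman (MatObj A),
      -- the equivalences are additive and compatible with the embeddings of `A`
      e.functor.Additive ∧ e.inverse.Additive ∧
      Nonempty (ringToFPFun A ⋙ e.functor ≅ ringToAdelman A) ∧
      Nonempty (ringToAdelman A ⋙ e.inverse ≅ ringToFPFun A) ∧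
      -- the formula for `e.functor`
      (∀ (F : FPFun A) (X Y : FPMod A) (f : X ⟶ Y) (_ : ProjPresentation f F)
        (m n k l : ℕ) (a : Matrix (Fin n) (Fin m) A) (b : Matrix (Fin k) (Fin m) A)
        (c : Matrix (Fin l) (Fin n) A) (d : Matrix (Fin l) (Fin k) A) (_ : FreeDiagram a b c d f),
        Nonempty (e.functor.obj (op F) ≅ blockChain a b c d)) ∧
      -- the formula for `e.inverse`
      (∀ (m n r : ℕ) (u : Matrix (Fin n) (Fin m) A) (v : Matrix (Fin r) (Fin n) A)
        (X Y : FPMod A) (f : X ⟶ Y) (_ : FreeDiagram u 1 v (v * u) f),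
        Nonempty (ProjPresentation f (e.inverse.obj (matChain u v)).unop)) := by
  refine ⟨exists_projPresentation, fun _ _ => exists_freeDiagram,
    fun _ _ _ => exists_freeDiagram_of_chain, ?_⟩
  let E := (adelmanToFPFun A).asEquivalence
  have hE : E.functor.Additive := inferInstanceAs (adelmanToFPFun A).Additive
  let η : ringToAdelman A ⋙ E.functor ≅ ringToFPFun A :=
    Functor.isoWhiskerLeft (ringToMat A) (toAdelmanCompIso A)
  -- `E` starts at Adelman's category, so it is reversed. The inverse of `E.symm` is cohomology
  -- itself, so its formula applies directly; statements about the functor of `E.symm` are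
  -- transported along the unit of `E`.
  refine ⟨E.symm, E.inverse_additive, hE, ⟨?_⟩, ⟨η⟩, ?_, ?_⟩
  · exact Functor.isoWhiskerRight η.symm E.inverse ≪≫
      Functor.isoWhiskerLeft (ringToAdelman A) E.unitIso.symm ≪≫ (ringToAdelman A).rightUnitor
  · intro F X Y f hF m n k l a b c d D
    obtain ⟨i⟩ := nonempty_obj_blockChain_iso hF D
    exact ⟨E.inverse.mapIso i.symm ≪≫ (E.unitIso.app _).symm⟩
  · intro m n r u v X Y f D
    exact nonempty_projPresentation_of_chain D
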